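/- All graphs are finite and simple. Let $\Delta(G)$, $\delta(G)$ be the maximum and minimum degree of $G$, let $\chi'(G)$ be its chromatic index, and let $V_i(G)$ be the set of its vertices of degree $i$. For $k\ge 2$ a graph $G$ is $k$-critical if $\Delta(G)=k$, $\chi'(G)=k+1$ and $\chi'(G-e)=k$ for every $e\in E(G)$. For $k\ge 2$ and $t\ge 0$ let $\mathcal C(k,t)$ be the set of $k$-critical graphs $G$ such that $\delta(G)\ge k-1$ and one can choose, for every $v\in V_{k-1}(G)$, paths $p_1(v),\dots,p_{k-1}(v)$ in $G$ with initial vertex $v$ such that for all $v\in V_{k-1}(G)$ and all $i,j\in\{1,\dots,k-1\}$: (a) $V(p_i(v))\cap V_{k-1}(G)=\{v\}$; (b) $|V(p_i(v))|\ge 2t(k-1)+2$; (c) if $i\ne j$, then $V(p_i(v))\cap V(p_j(v))=\{v\}$; (d) if $w\in V_{k-1}(G)$ and $w\ne v$, then $V(p_i(v))\cap V(p_j(w))=\emptyset$. Let $G$ be a graph with $\Delta(G)=k$, let $v$ be a vertex of $G$ and let $v_1,\dots,v_d$ be its neighbors. Let $u_1,\dots,u_k$ be the vertices of degree $k-1$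 of a complete bipartite graph $K_{k,k-1}$ disjoint from $G$. The graph obtained from the disjoint union of $G-v$ and $K_{k,k-1}$ by adding the edges $v_iu_i$ for $1\le i\le d$ is called a Meredith extension of $G$ (applied on $v$). Lemma. For every $k\ge 2$ and every $t\ge 0$, and for every $k$-critical graph $G$ without isolated vertices, some graph $H\in\mathcal C(k,t)$ is obtained (up to isomorphism) from $G$ by a finite, possibly empty, sequence of Meredith extensions. -/

import Mathlib

universe u

namespace CriticalGraphs

section Basic

variable {V : Type u}

/-- The chromatic index: the chromatic number of the line graph, that is, the least number of
colours in a colouring of the edges in which adjacent edges receive different colours. -/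
noncomputable def chromaticIndex (G : SimpleGraph V) : ℕ∞ :=
  G.lineGraph.chromaticNumber

open Classical in
/-- The graph `G` is `k`-critical: it has maximum degree `k` and chromatic index `k + 1`, and the
removal of any edge lowers the chromatic index to `k`. -/
def IsCritical (k : ℕ) (G : SimpleGraph V) [Fintype V] : Prop :=
  G.maxDegree = k ∧ chromaticIndex G = (k : ℕ∞) + 1 ∧
    ∀ e ∈ G.edgeSet, chromaticIndex (G.deleteEdges {e}) = (k : ℕ∞)

open Classical in
/-- The set `V_i(G)` of the vertices of degree `i`. -/
def degreeSet (G : SimpleGraph V) [Fintype V] (i : ℕ) : Set V :=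
  {v | G.degree v = i}

/-- The vertex set `V(p)` of a walk `p`. -/
def walkVerts {G : SimpleGraph V} {a b : V} (p : G.Walk a b) : Set V :=
  {x | x ∈ p.support}

/-- There is a simultaneous choice of `k - 1` distinguished paths `p v i` (ending in `z v i`) for
every vertex `v` of degree `k - 1`. The values of `z` and `p` at other vertices play no role. -/
def HasDistinguishedPaths (k t : ℕ) (G : SimpleGraph V) [Fintype V] : Prop :=
  ∃ (z : V → Fin (k - 1) → V) (p : ∀ (v : V) (i : Fin (k - 1)), G.Walk v (z v i)),
    ∀ v ∈ degreeSet G (k - 1),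
      (∀ i, (p v i).IsPath) ∧
      (∀ i, walkVerts (p v i) ∩ degreeSet G (k - 1) = {v}) ∧
      (∀ i, 2 * t * (k - 1) + 2 ≤ (walkVerts (p v i)).ncard) ∧
      (∀ i j, i ≠ j → walkVerts (p v i) ∩ walkVerts (p v j) = {v}) ∧
      (∀ w ∈ degreeSet G (k - 1), w ≠ v →
        ∀ i j, walkVerts (p v i) ∩ walkVerts (p w j) = ∅)

/-- The graph obtained from the disjoint union of `G - v` and the complete bipartite graph
`K_{k,k-1}` by joining every neighbour `x` of `v` to the vertex `u x` of the side with `k`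
vertices (which are the vertices of degree `k - 1` of `K_{k,k-1}`); here `u` is injective. -/
def meredithGraph (k : ℕ) (G : SimpleGraph V) (v : V) (u : G.neighborSet v ↪ Fin k) :
    SimpleGraph (({v}ᶜ : Set V) ⊕ (Fin k ⊕ Fin (k - 1))) :=
  (G.induce ({v}ᶜ : Set V) ⊕g completeBipartiteGraph (Fin k) (Fin (k - 1))) ⊔
    SimpleGraph.fromRel (fun a b => ∃ (x : ({v}ᶜ : Set V)) (hx : (x : V) ∈ G.neighborSet v),
      a = Sum.inl x ∧ b = Sum.inr (Sum.inl (u ⟨x, hx⟩)))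

end Basic

/-- A finite simple graph, bundled with its vertex type. -/
structure FinGraph : Type (u + 1) where
  V : Type u
  [fintypeV : Fintype V]
  graph : SimpleGraph V

attribute [instance] FinGraph.fintypeV

/-- The class `C(k)` of `k`-critical graphs. -/
def criticalClass (k : ℕ) : Set FinGraph.{u} :=
  {G | IsCritical k G.graph}

open Classical in
/-- The class `C(k,t)`. -/
def criticalClassPaths (k t : ℕ) : Set FinGraph.{u} :=
  {G | G ∈ criticalClass k ∧ k - 1 ≤ G.graph.minDegree ∧ HasDistinguishedPaths k t G.graph}

open Classical in
/-- `H` is (up to isomorphism) a Meredith extension of `G`, where `G` has maximum degree `k`. -/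
def IsMeredithExtension (k : ℕ) (G H : FinGraph.{u}) : Prop :=
  G.graph.maxDegree = k ∧ ∃ (v : G.V) (u : G.graph.neighborSet v ↪ Fin k),
    Nonempty (meredithGraph k G.graph v u ≃g H.graph)

end CriticalGraphs

namespace CriticalGraphs

open Function

/-! A Meredith extension at a non-isolated vertex `v` of a `k`-critical graph is again `k`-critical
(`IsCritical.meredithGraph`). Contracting `K_{k,k-1}` back to `v` turns a `k`-edge-colouring of the
extension into one of `G`, because the edges leaving `K_{k,k-1}` carry distinct colours
(`IsEdgeColoring.left_eq_of_pendant_eq`); so the extension has no such colouring. Conversely, a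
colouring of `G - e` extends over `K_{k,k-1}` by the Latin rectangle `n a + τ b` over `Fin k`, whose
row `a` misses exactly the colour `n a` reserved for the edge leaving at `a`. This handles the
removal of edges outside `K_{k,k-1}`; for an edge inside it, one entry of the rectangle is altered
(`edgeColorable_deleteEdges_left_right`).

The extension keeps the degrees of the vertices other than `v`, and its new vertices have degree
`k`, except the left vertices not matched to a neighbour of `v`, which have degree `k - 1`.
Extending at vertices of degree below `k - 1` therefore leads to minimum degree at least `k - 1`. If
`v` has degree `k - 1`, exactly one left vertex is unmatched. It takes over the role of `v`, and
each path of `v` is rerouted through `K_{k,k-1}`, gaining two vertices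
(`IsPathSystem.meredithGraph`). Starting from trivial paths and repeating, all paths become long
enough. Both processes stop because a sum over the vertices decreases (`sum_lt_sum_of_inl_le`). -/

/-- `c` assigns to adjacent edges of `G` distinct colours. -/
def IsEdgeColoring {V : Type u} {C : Type*} (G : SimpleGraph V) (c : V → V → C) : Prop :=
  (∀ a b, G.Adj a b → c a b = c b a) ∧
    ∀ a b b', G.Adj a b → G.Adj a b' → c a b = c a b' → b = b'

/-- The edges of `G` can be properly coloured with `n` colours. -/
def EdgeColorable {V : Type u} (G : SimpleGraph V) (n : ℕ) : Prop :=
  ∃ c : V → V → Fin n, IsEdgeColoring G c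

/-! ### Edge colourings and criticality -/

section Coloring

variable {V : Type u} {G : SimpleGraph V} {n k : ℕ}

/-- Off the edges the function on pairs takes the junk value `0`, which needs at least one colour.
-/
lemma lineGraph_colorable_iff [NeZero n] : G.lineGraph.Colorable n ↔ EdgeColorable G n := by
  classical
  constructor
  · rintro ⟨C⟩
    refine ⟨fun a b => if h : G.Adj a b then C ⟨s(a, b), h⟩ else 0, ?_, ?_⟩
    · intro a b h
      simp only [h, h.symm, dif_pos]
      congr 2
      exact Sym2.eq_swap
    · intro a b b' h h' hc
      simp only [h, h', dif_pos] at hc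
      by_contra hne
      refine C.valid (v := ⟨s(a, b), h⟩) (w := ⟨s(a, b'), h'⟩) ?_ hc
      refine ⟨?_, a, ?_⟩
      · exact fun h => hne (Sym2.congr_right.1 (congrArg Subtype.val h))
      · simp
  · rintro ⟨c, hs, hp⟩
    have key : ∀ e : G.edgeSet, ∃ x : Fin n, ∀ a b, (e : Sym2 V) = s(a, b) → x = c a b := by
      rintro ⟨e, he⟩
      induction e with
      | h p q =>
        refine ⟨c p q, fun a b hab => ?_⟩
        rcases Sym2.eq_iff.1 hab with ⟨rfl, rfl⟩ | ⟨rfl, rfl⟩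
        · rfl
        · exact hs _ _ he
    choose C hC using key
    refine ⟨SimpleGraph.Coloring.mk C ?_⟩
    rintro ⟨e, he⟩ ⟨e', he'⟩ ⟨hne, a, ha, ha'⟩ heq
    obtain ⟨b, rfl⟩ := Sym2.mem_iff_exists.1 ha
    obtain ⟨b', rfl⟩ := Sym2.mem_iff_exists.1 ha'
    rw [hC _ a b rfl, hC _ a b' rfl] at heq
    exact hne (by simp [hp a b b' he he' heq])

/-- A colour missing at both ends of a deleted edge may be used for this edge. -/
lemma IsEdgeColoring.edgeColorable_of_missing {p q : V} {c : V → V → Fin n} {x : Fin n}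
    (hc : IsEdgeColoring (G.deleteEdges {s(p, q)}) c)
    (hp : ∀ y, (G.deleteEdges {s(p, q)}).Adj p y → c p y ≠ x)
    (hq : ∀ y, (G.deleteEdges {s(p, q)}).Adj q y → c q y ≠ x) : EdgeColorable G n := by
  classical
  have key : ∀ a b b', G.Adj a b' → s(a, b) = s(p, q) → s(a, b') ≠ s(p, q) → c a b' ≠ x := by
    intro a b b' hab' h h'
    have hadj : (G.deleteEdges {s(p, q)}).Adj a b' := by
      rw [SimpleGraph.deleteEdges_adj]; exact ⟨hab', h'⟩
    rcases Sym2.eq_iff.1 h with ⟨rfl, rfl⟩ | ⟨rfl, rfl⟩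
    · exact hp _ hadj
    · exact hq _ hadj
  refine ⟨fun a b => if s(a, b) = s(p, q) then x else c a b, ?_, ?_⟩
  · intro a b hab
    have : s(b, a) = s(a, b) := Sym2.eq_swap
    simp only [this]
    split_ifs with h
    · rfl
    · rw [hc.1 a b (by rw [SimpleGraph.deleteEdges_adj]; exact ⟨hab, h⟩)]
  · intro a b b' hab hab' hcc
    by_cases h : s(a, b) = s(p, q) <;> by_cases h' : s(a, b') = s(p, q)
    · exact Sym2.congr_right.1 (h.trans h'.symm)
    · simp only [h, h', if_true, if_false] at hcc
      exact absurd hcc.symm (key a b b' hab' h h')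
    · simp only [h, h', if_true, if_false] at hcc
      exact absurd hcc (key a b' b hab h' h)
    · simp only [h, h', if_false] at hcc
      refine hc.2 a b b' ?_ ?_ hcc
      · rw [SimpleGraph.deleteEdges_adj]; exact ⟨hab, h⟩
      · rw [SimpleGraph.deleteEdges_adj]; exact ⟨hab', h'⟩

lemma EdgeColorable.of_deleteEdges {p q : V}
    (h : EdgeColorable (G.deleteEdges {s(p, q)}) n) : EdgeColorable G (n + 1) := by
  obtain ⟨c, hs, hp⟩ := h
  refine IsEdgeColoring.edgeColorable_of_missing (x := Fin.last n) (p := p) (q := q)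
    (c := fun a b => (c a b).castSucc)
    ⟨fun a b hab => congrArg _ (hs a b hab),
      fun a b b' hab hab' hcc => hp a b b' hab hab' (Fin.castSucc_injective _ hcc)⟩ ?_ ?_
  · exact fun y _ => Fin.castSucc_ne_last _
  · exact fun y _ => Fin.castSucc_ne_last _

lemma degree_eq_ncard [Fintype V] (x : V) [Fintype (G.neighborSet x)] :
    G.degree x = (G.neighborSet x).ncard := by
  rw [← SimpleGraph.card_neighborSet_eq_degree, Set.ncard_eq_toFinset_card', Set.toFinset_card]

lemma maxDegree_eq_iff [Fintype V] [DecidableRel G.Adj] (hk : 0 < k) :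
    G.maxDegree = k ↔
      (∀ x, (G.neighborSet x).ncard ≤ k) ∧ ∃ x, (G.neighborSet x).ncard = k := by
  constructor
  · rintro rfl
    refine ⟨fun x => degree_eq_ncard (G := G) x ▸ G.degree_le_maxDegree x, ?_⟩
    have : Nonempty V := by
      by_contra h
      rw [not_nonempty_iff] at h
      simp at hk
    obtain ⟨x, hx⟩ := G.exists_maximal_degree_vertex
    exact ⟨x, by rw [hx, degree_eq_ncard]⟩
  · rintro ⟨h, x, hx⟩
    refine le_antisymm (G.maxDegree_le_of_forall_degree_le _ fun y => ?_) ?_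
    · rw [degree_eq_ncard]; exact h y
    · rw [← hx, ← degree_eq_ncard]; exact G.degree_le_maxDegree x

/-- Restoring a deleted edge costs at most one new colour. So colouring `G - e` with `k` colours
gives the upper bound `k + 1` for `G`, and colouring it with `k - 1` would give a `k`-colouring of
`G`. -/
lemma isCritical_iff [Fintype V] (hk : 2 ≤ k) :
    IsCritical k G ↔
      ((∀ x, (G.neighborSet x).ncard ≤ k) ∧ ∃ x, (G.neighborSet x).ncard = k) ∧
      ¬ EdgeColorable G k ∧
      ∀ a b, G.Adj a b → EdgeColorable (G.deleteEdges {s(a, b)}) k := by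
  classical
  have : NeZero k := ⟨by omega⟩
  have : NeZero (k - 1) := ⟨by omega⟩
  unfold IsCritical chromaticIndex
  rw [← maxDegree_eq_iff (by omega : 0 < k)]
  constructor
  · rintro ⟨h1, h2, h3⟩
    refine ⟨by convert h1, fun h => ?_, fun a b hab => ?_⟩
    · have := (lineGraph_colorable_iff.2 h).chromaticNumber_le
      rw [h2] at this
      exact absurd this (by norm_cast; omega)
    · exact lineGraph_colorable_iff.1
        (SimpleGraph.chromaticNumber_le_iff_colorable.1 (h3 _ hab).le)
  · rintro ⟨h1, h2, h3⟩
    refine ⟨by convert h1, ?_, ?_⟩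
    · obtain ⟨x, hx⟩ := ((maxDegree_eq_iff (by omega : 0 < k)).1 h1).2
      obtain ⟨y, hy⟩ : (G.neighborSet x).Nonempty := by
        rw [← Set.ncard_pos, hx]; omega
      refine le_antisymm ?_ ?_
      · have := (lineGraph_colorable_iff.2 (h3 x y hy).of_deleteEdges).chromaticNumber_le
        simpa using this
      · refine Order.add_one_le_of_lt (lt_of_not_ge fun h => h2 ?_)
        exact lineGraph_colorable_iff.1 (SimpleGraph.chromaticNumber_le_iff_colorable.1 h)
    · intro e he
      induction e with
      | h a b =>
        refine le_antisymm (lineGraph_colorable_iff.2 (h3 a b he)).chromaticNumber_le ?_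
        have hk1 : (k : ℕ∞) = ((k - 1 : ℕ) : ℕ∞) + 1 := by norm_cast; omega
        conv_lhs => rw [hk1]
        refine Order.add_one_le_of_lt (lt_of_not_ge fun h => h2 ?_)
        have := (lineGraph_colorable_iff.1
          (SimpleGraph.chromaticNumber_le_iff_colorable.1 h)).of_deleteEdges
        rwa [Nat.sub_add_cancel (by omega)] at this

end Coloring

/-! ### Adjacency and degrees in a Meredith extension -/

section Meredith

variable {V : Type u} {G : SimpleGraph V} {k : ℕ} {v : V} {u : G.neighborSet v ↪ Fin k}

@[simp] lemma meredithGraph_adj_inl_inl (x y : ({v}ᶜ : Set V)) :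
    (meredithGraph k G v u).Adj (Sum.inl x) (Sum.inl y) ↔ G.Adj x y := by
  simp [meredithGraph]

@[simp] lemma meredithGraph_adj_inl_inr_inl (x : ({v}ᶜ : Set V)) (a : Fin k) :
    (meredithGraph k G v u).Adj (Sum.inl x) (Sum.inr (Sum.inl a)) ↔
      ∃ hx : G.Adj v x, u ⟨x, hx⟩ = a := by
  simp only [meredithGraph, SimpleGraph.sup_adj, SimpleGraph.fromRel_adj]
  constructor
  · rintro (h | ⟨-, ⟨y, hy, h, h'⟩ | ⟨y, hy, h, h'⟩⟩)
    · simp at h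
    · obtain rfl := Sum.inl_injective h
      exact ⟨hy, (Sum.inl_injective (Sum.inr_injective h')).symm⟩
    · simp at h
  · rintro ⟨hx, rfl⟩
    exact Or.inr ⟨by simp, Or.inl ⟨x, hx, rfl, rfl⟩⟩

@[simp] lemma meredithGraph_adj_inr_inl_inl (x : ({v}ᶜ : Set V)) (a : Fin k) :
    (meredithGraph k G v u).Adj (Sum.inr (Sum.inl a)) (Sum.inl x) ↔
      ∃ hx : G.Adj v x, u ⟨x, hx⟩ = a := by
  rw [SimpleGraph.adj_comm, meredithGraph_adj_inl_inr_inl]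

@[simp] lemma meredithGraph_adj_inl_inr_inr (x : ({v}ᶜ : Set V)) (b : Fin (k - 1)) :
    ¬ (meredithGraph k G v u).Adj (Sum.inl x) (Sum.inr (Sum.inr b)) := by
  simp [meredithGraph]

@[simp] lemma meredithGraph_adj_inr_inr_inl (x : ({v}ᶜ : Set V)) (b : Fin (k - 1)) :
    ¬ (meredithGraph k G v u).Adj (Sum.inr (Sum.inr b)) (Sum.inl x) := by
  simp [meredithGraph]

@[simp] lemma meredithGraph_adj_left_left (a a' : Fin k) :
    ¬ (meredithGraph k G v u).Adj (Sum.inr (Sum.inl a)) (Sum.inr (Sum.inl a')) := by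
  simp [meredithGraph]

@[simp] lemma meredithGraph_adj_left_right (a : Fin k) (b : Fin (k - 1)) :
    (meredithGraph k G v u).Adj (Sum.inr (Sum.inl a)) (Sum.inr (Sum.inr b)) := by
  simp [meredithGraph]

@[simp] lemma meredithGraph_adj_right_left (a : Fin k) (b : Fin (k - 1)) :
    (meredithGraph k G v u).Adj (Sum.inr (Sum.inr b)) (Sum.inr (Sum.inl a)) := by
  simp [meredithGraph]

@[simp] lemma meredithGraph_adj_right_right (b b' : Fin (k - 1)) :
    ¬ (meredithGraph k G v u).Adj (Sum.inr (Sum.inr b)) (Sum.inr (Sum.inr b')) := by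
  simp [meredithGraph]

/-- If `x` was adjacent to `v`, its partner `u x` takes the place of `v` among its neighbours. -/
lemma ncard_neighborSet_inl (x : ({v}ᶜ : Set V)) :
    ((meredithGraph k G v u).neighborSet (Sum.inl x)).ncard = (G.neighborSet x).ncard := by
  classical
  by_cases hx : G.Adj v x
  · let f : V → ({v}ᶜ : Set V) ⊕ (Fin k ⊕ Fin (k - 1)) := fun y =>
      if h : y = v then Sum.inr (Sum.inl (u ⟨x, hx⟩)) else Sum.inl ⟨y, h⟩
    have hf : Injective f := by
      intro y z h
      by_cases hy : y = v <;> by_cases hz : z = v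
      · rw [hy, hz]
      · simp [f, hy, hz] at h
      · simp [f, hy, hz] at h
      · simp only [f, hy, hz, dif_neg, not_false_iff] at h
        exact congrArg Subtype.val (Sum.inl_injective h)
    rw [← Set.ncard_image_of_injective _ hf]
    congr 1
    ext (y | a | b)
    · simp only [SimpleGraph.mem_neighborSet, meredithGraph_adj_inl_inl, Set.mem_image]
      constructor
      · exact fun h => ⟨y, h, by simp [f, show (y : V) ≠ v from y.2]⟩
      · rintro ⟨z, hz, h⟩
        by_cases hzv : z = v
        · simp [f, hzv] at h
        · simp only [f, hzv, dif_neg, not_false_iff, Sum.inl.injEq] at h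
          subst h; exact hz
    · simp only [SimpleGraph.mem_neighborSet, meredithGraph_adj_inl_inr_inl, Set.mem_image]
      constructor
      · rintro ⟨_, h⟩
        exact ⟨v, hx.symm, by simp [f, h]⟩
      · rintro ⟨z, hz, h⟩
        by_cases hzv : z = v
        · simp only [f, hzv, dif_pos, Sum.inr.injEq, Sum.inl.injEq] at h
          exact ⟨hx, h⟩
        · simp [f, hzv] at h
    · simp only [SimpleGraph.mem_neighborSet, meredithGraph_adj_inl_inr_inr, Set.mem_image,
        false_iff]
      rintro ⟨z, hz, h⟩
      by_cases hzv : z = v <;> simp [f, hzv] at h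
  · have : G.neighborSet x = Subtype.val '' {y : ({v}ᶜ : Set V) | G.Adj x y} := by
      ext y
      simp only [SimpleGraph.mem_neighborSet, Set.mem_image, Set.mem_ofPred_eq]
      constructor
      · intro h
        refine ⟨⟨y, fun hy => hx ?_⟩, h, rfl⟩
        obtain rfl := Set.mem_singleton_iff.1 hy
        exact h.symm
      · rintro ⟨z, hz, rfl⟩; exact hz
    rw [this, Set.ncard_image_of_injective _ Subtype.val_injective,
      ← Set.ncard_image_of_injective {y : ({v}ᶜ : Set V) | G.Adj x y}
        (Sum.inl_injective (β := Fin k ⊕ Fin (k - 1)))]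
    refine congrArg Set.ncard (Set.ext ?_)
    rintro (y | a | b) <;> simp [hx]

lemma ncard_neighborSet_right (b : Fin (k - 1)) :
    ((meredithGraph k G v u).neighborSet (Sum.inr (Sum.inr b))).ncard = k := by
  have : (meredithGraph k G v u).neighborSet (Sum.inr (Sum.inr b)) =
      Set.range (fun a : Fin k => Sum.inr (Sum.inl a)) := by
    ext (y | a | b) <;> simp
  rw [this, ← Set.image_univ, Set.ncard_image_of_injective _ fun a b h =>
    Sum.inl_injective (Sum.inr_injective h), Set.ncard_univ, Nat.card_fin]

lemma ncard_range_right : (Set.range fun b : Fin (k - 1) =>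
    (Sum.inr (Sum.inr b) : ({v}ᶜ : Set V) ⊕ (Fin k ⊕ Fin (k - 1)))).ncard = k - 1 := by
  rw [← Set.image_univ, Set.ncard_image_of_injective _ fun a b h =>
    Sum.inr_injective (Sum.inr_injective h), Set.ncard_univ, Nat.card_fin]

lemma ncard_neighborSet_left_of_notMem {a : Fin k} (ha : a ∉ Set.range u) :
    ((meredithGraph k G v u).neighborSet (Sum.inr (Sum.inl a))).ncard = k - 1 := by
  refine Eq.trans (congrArg Set.ncard (Set.ext ?_)) (ncard_range_right (V := V) (v := v))
  rintro (y | a' | b)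
  · simp only [SimpleGraph.mem_neighborSet, meredithGraph_adj_inr_inl_inl, Set.mem_range,
      reduceCtorEq, exists_false, iff_false]
    rintro ⟨hx, h⟩
    exact ha ⟨_, h⟩
  · simp
  · simp

lemma ncard_neighborSet_left_of_mem {a : Fin k} (ha : a ∈ Set.range u) :
    ((meredithGraph k G v u).neighborSet (Sum.inr (Sum.inl a))).ncard = k := by
  obtain ⟨⟨x, hx⟩, rfl⟩ := ha
  have hxv : x ∈ ({v}ᶜ : Set V) := fun h => G.ne_of_adj hx (Set.mem_singleton_iff.1 h).symm
  have : (meredithGraph k G v u).neighborSet (Sum.inr (Sum.inl (u ⟨x, hx⟩))) =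
      insert (Sum.inl ⟨x, hxv⟩) (Set.range fun b : Fin (k - 1) => Sum.inr (Sum.inr b)) := by
    ext (y | a' | b)
    · simp only [SimpleGraph.mem_neighborSet, meredithGraph_adj_inr_inl_inl,
        EmbeddingLike.apply_eq_iff_eq, Set.mem_insert_iff, Sum.inl.injEq,
        Set.mem_range, reduceCtorEq, exists_false, or_false]
      constructor
      · rintro ⟨_, h⟩; have h' := congrArg Subtype.val h; exact Subtype.ext h'
      · rintro rfl; exact ⟨hx, rfl⟩
    · simp
    · simp
  rw [this, Set.ncard_insert_of_notMem (by simp) (Set.toFinite _), ncard_range_right]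
  have := (u ⟨x, hx⟩).pos
  omega

lemma le_ncard_neighborSet_inr (a : Fin k ⊕ Fin (k - 1)) :
    k - 1 ≤ ((meredithGraph k G v u).neighborSet (Sum.inr a)).ncard := by
  rcases a with a | b
  · by_cases ha : a ∈ Set.range u
    · rw [ncard_neighborSet_left_of_mem ha]; omega
    · rw [ncard_neighborSet_left_of_notMem ha]
  · rw [ncard_neighborSet_right]; omega

lemma ncard_neighborSet_inr_le (a : Fin k ⊕ Fin (k - 1)) :
    ((meredithGraph k G v u).neighborSet (Sum.inr a)).ncard ≤ k := by
  rcases a with a | b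
  · by_cases ha : a ∈ Set.range u
    · rw [ncard_neighborSet_left_of_mem ha]
    · rw [ncard_neighborSet_left_of_notMem ha]; omega
  · rw [ncard_neighborSet_right]

end Meredith

/-! ### Passing between colourings of a graph and of its Meredith extension -/

section Meredith

variable {V : Type u} {G : SimpleGraph V} {k : ℕ} {v : V} {u : G.neighborSet v ↪ Fin k}

/-- A colouring `c` of `G'` (proper away from `v`) and a colouring `L` of a part `R` of `K_{k,k-1}`
combine to an edge colouring of a subgraph of a Meredith extension. -/
lemma edgeColorable_of_le_meredithGraph [NeZero k] {n : ℕ} [NeZero n]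
    {M : SimpleGraph (({v}ᶜ : Set V) ⊕ (Fin k ⊕ Fin (k - 1)))} {G' : SimpleGraph V}
    {R : Fin k → Fin (k - 1) → Prop} (hM : M ≤ meredithGraph k G v u)
    (hG' : ∀ x y : ({v}ᶜ : Set V), M.Adj (Sum.inl x) (Sum.inl y) → G'.Adj x y)
    (hv : ∀ (x : ({v}ᶜ : Set V)) a, M.Adj (Sum.inl x) (Sum.inr (Sum.inl a)) → G'.Adj v x)
    (hR : ∀ a b, M.Adj (Sum.inr (Sum.inl a)) (Sum.inr (Sum.inr b)) → R a b)
    (c : V → V → Fin n) (L : Fin k → Fin (k - 1) → Fin n)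
    (hsymm : ∀ x y, G'.Adj x y → c x y = c y x)
    (hc : ∀ x, x ≠ v → ∀ y y', G'.Adj x y → G'.Adj x y' → c x y = c x y' → y = y')
    (hrow : ∀ a b b', R a b → R a b' → L a b = L a b' → b = b')
    (hcol : ∀ a a' b, R a b → R a' b → L a b = L a' b → a = a')
    (hcL : ∀ x (hx : G.Adj v x), G'.Adj v x → ∀ b, R (u ⟨x, hx⟩) b → c v x ≠ L (u ⟨x, hx⟩) b) :
    EdgeColorable M n := by
  have hu : ∀ (x : ({v}ᶜ : Set V)) a, M.Adj (Sum.inl x) (Sum.inr (Sum.inl a)) →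
      ∃ hx : G.Adj v x, u ⟨x, hx⟩ = a := fun x a h => by simpa using hM h
  have hne : ∀ x : ({v}ᶜ : Set V), (x : V) ≠ v := fun x => x.2
  let col : (({v}ᶜ : Set V) ⊕ (Fin k ⊕ Fin (k - 1))) →
      (({v}ᶜ : Set V) ⊕ (Fin k ⊕ Fin (k - 1))) → Fin n := fun p q =>
    match p, q with
    | Sum.inl x, Sum.inl y => c x y
    | Sum.inl x, Sum.inr _ => c v x
    | Sum.inr _, Sum.inl x => c v x
    | Sum.inr (Sum.inl a), Sum.inr (Sum.inr b) => L a b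
    | Sum.inr (Sum.inr b), Sum.inr (Sum.inl a) => L a b
    | _, _ => 0
  refine ⟨col, ?_, ?_⟩
  · rintro (x | a | b) (y | a' | b') h
    · exact hsymm _ _ (hG' _ _ h)
    all_goals rfl
  · rintro (x | a | b) (y | a' | b') (y' | a'' | b'') h h' hcc
    · exact congrArg Sum.inl (Subtype.ext (hc x (hne x) y y' (hG' _ _ h) (hG' _ _ h') hcc))
    · have h2 := (hv _ _ h').symm
      have : c x y = c x v := hcc.trans (hsymm _ _ h2.symm)
      exact absurd (hc x (hne x) y v (hG' _ _ h) h2 this) (hne y)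
    · exact absurd (hM h') (by simp)
    · have h2 := (hv _ _ h).symm
      have : c x y' = c x v := hcc.symm.trans (hsymm _ _ h2.symm)
      exact absurd (hc x (hne x) y' v (hG' _ _ h') h2 this) (hne y')
    · obtain ⟨hx, rfl⟩ := hu _ _ h
      obtain ⟨hx, rfl⟩ := hu _ _ h'
      rfl
    · exact absurd (hM h') (by simp)
    · exact absurd (hM h) (by simp)
    · exact absurd (hM h) (by simp)
    · exact absurd (hM h) (by simp)
    · obtain ⟨hx, h1⟩ := hu _ _ h.symm
      obtain ⟨hx', h2⟩ := hu _ _ h'.symm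
      have h3 := congrArg Subtype.val (u.injective (h1.trans h2.symm))
      exact congrArg Sum.inl (Subtype.ext h3)
    · exact absurd (hM h') (by simp)
    · obtain ⟨hx, rfl⟩ := hu _ _ h.symm
      exact absurd hcc (hcL _ hx (hv _ _ h.symm) _ (hR _ _ h'))
    · exact absurd (hM h) (by simp)
    · exact absurd (hM h) (by simp)
    · exact absurd (hM h) (by simp)
    · obtain ⟨hx, rfl⟩ := hu _ _ h'.symm
      exact absurd hcc.symm (hcL _ hx (hv _ _ h'.symm) _ (hR _ _ h))
    · exact absurd (hM h') (by simp)
    · rw [hrow _ _ _ (hR _ _ h) (hR _ _ h') hcc]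
    · exact absurd (hM h) (by simp)
    · exact absurd (hM h) (by simp)
    · exact absurd (hM h) (by simp)
    · exact absurd (hM h') (by simp)
    · rw [hcol _ _ _ (hR _ _ h.symm) (hR _ _ h'.symm) hcc]
    · exact absurd (hM h') (by simp)
    · exact absurd (hM h) (by simp)
    · exact absurd (hM h) (by simp)
    · exact absurd (hM h) (by simp)

/-- Each vertex of full degree sees all colours; hence in a `k`-edge-colouring of a Meredith
extension the edges leaving the copy of `K_{k,k-1}` have distinct colours. -/
lemma IsEdgeColoring.left_eq_of_pendant_eq {col : (({v}ᶜ : Set V) ⊕ (Fin k ⊕ Fin (k - 1))) →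
    (({v}ᶜ : Set V) ⊕ (Fin k ⊕ Fin (k - 1))) → Fin k}
    (hcol : IsEdgeColoring (meredithGraph k G v u) col) {a a' : Fin k} {x x' : ({v}ᶜ : Set V)}
    (h : (meredithGraph k G v u).Adj (Sum.inr (Sum.inl a)) (Sum.inl x))
    (h' : (meredithGraph k G v u).Adj (Sum.inr (Sum.inl a')) (Sum.inl x'))
    (hc : col (Sum.inr (Sum.inl a)) (Sum.inl x) = col (Sum.inr (Sum.inl a')) (Sum.inl x')) :
    a = a' := by
  classical
  by_contra hne
  have hsurj : ∀ b : Fin (k - 1), Surjective fun a =>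
      col (Sum.inr (Sum.inr b)) (Sum.inr (Sum.inl a)) := by
    intro b
    refine Finite.surjective_of_injective fun a a' h => ?_
    exact Sum.inl_injective (Sum.inr_injective (hcol.2 _ _ _ (by simp) (by simp) h))
  choose g hg using fun b => hsurj b (col (Sum.inr (Sum.inl a)) (Sum.inl x))
  have hcg : ∀ b, col (Sum.inr (Sum.inl (g b))) (Sum.inr (Sum.inr b)) =
      col (Sum.inr (Sum.inl a)) (Sum.inl x) := fun b =>
    (hcol.1 _ _ (by simp)).trans (hg b)
  have hginj : Injective g := by
    intro b b' hb
    have h1 := hcg b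
    rw [hb, ← hcg b'] at h1
    exact Sum.inr_injective (Sum.inr_injective (hcol.2 _ _ _ (by simp) (by simp) h1))
  have hga : ∀ b, g b ≠ a := by
    rintro b rfl
    exact absurd (hcol.2 _ _ _ (by simp) h (hcg b)) (by simp)
  have hga' : ∀ b, g b ≠ a' := by
    rintro b rfl
    exact absurd (hcol.2 _ _ _ (by simp) h' ((hcg b).trans hc)) (by simp)
  -- The edges of this colour match the `k - 1` right vertices injectively into the left vertices
  -- other than `a` and `a'`, of which there are only `k - 2`.
  have hsub : Finset.univ.image g ⊆ (Finset.univ.erase a).erase a' := by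
    intro z hz
    obtain ⟨b, -, rfl⟩ := Finset.mem_image.1 hz
    simp [hga, hga']
  have hcard := Finset.card_le_card hsub
  rw [Finset.card_image_of_injective _ hginj, Finset.card_erase_of_mem (by simp [Ne.symm hne]),
    Finset.card_erase_of_mem (by simp)] at hcard
  simp only [Finset.card_univ, Fintype.card_fin] at hcard
  have h1 := a.2
  have h2 := a'.2
  have h3 : (a : ℕ) ≠ a' := fun h => hne (Fin.ext h)
  omega

/-- Contract `K_{k,k-1}` to `v`: the edge `vx` inherits the colour of the edge from `x` to `u x`,
and these colours are distinct by `IsEdgeColoring.left_eq_of_pendant_eq`. -/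
lemma EdgeColorable.of_meredithGraph [NeZero k] (h : EdgeColorable (meredithGraph k G v u) k) :
    EdgeColorable G k := by
  classical
  obtain ⟨col, hcol⟩ := h
  have hne : ∀ {x y}, G.Adj x y → x ≠ y := fun h => G.ne_of_adj h
  let p : V → Fin k := fun x => if hx : G.Adj v x then
    col (Sum.inr (Sum.inl (u ⟨x, hx⟩))) (Sum.inl ⟨x, (hne hx).symm⟩) else 0
  let c : V → V → Fin k := fun x y =>
    if hx : x = v then p y else if hy : y = v then p x else col (Sum.inl ⟨x, hx⟩) (Sum.inl ⟨y, hy⟩)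
  refine ⟨c, ?_, ?_⟩
  · intro x y hxy
    by_cases hx : x = v <;> by_cases hy : y = v
    · rw [hx, hy]
    · simp [c, hx, hy]
    · simp [c, hx, hy]
    · simp only [c, hx, hy, dif_neg, not_false_iff]
      exact hcol.1 _ _ (by simpa using hxy)
  · intro x y y' hxy hxy' hcc
    by_cases hx : x = v
    · subst hx
      simp only [c, dif_pos, p, hxy, hxy'] at hcc
      have := hcol.left_eq_of_pendant_eq (by simpa) (by simpa) hcc
      exact congrArg Subtype.val (u.injective this)
    · by_cases hy : y = v <;> by_cases hy' : y' = v
      · rw [hy, hy']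
      · subst hy
        simp only [c, hx, hy', dif_pos, dif_neg, not_false_iff, p, hxy.symm] at hcc
        rw [hcol.1 _ _ (by simpa using hxy.symm)] at hcc
        exact absurd (hcol.2 _ _ _ (by simpa using hxy.symm) (by simpa using hxy') hcc) (by simp)
      · subst hy'
        simp only [c, hx, hy, dif_pos, dif_neg, not_false_iff, p, hxy'.symm] at hcc
        rw [hcol.1 (Sum.inr _) _ (by simpa using hxy'.symm)] at hcc
        exact absurd (hcol.2 _ _ _ (by simpa using hxy) (by simpa using hxy'.symm) hcc) (by simp)
      · simp only [c, hx, hy, hy', dif_neg, not_false_iff] at hcc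
        have := hcol.2 _ _ _ (by simpa using hxy) (by simpa using hxy') hcc
        exact congrArg Subtype.val (Sum.inl_injective this)

end Meredith

/-! ### Permutations and shifts for Latin rectangles over `Fin k` -/

section Permutations

variable {k : ℕ}

lemma exists_perm_extend {s : Set (Fin k)} {f : Fin k → Fin k} (hf : Set.InjOn f s) :
    ∃ n : Equiv.Perm (Fin k), ∀ a ∈ s, n a = f a := by
  classical
  obtain ⟨g, hg⟩ := Set.MapsTo.exists_equiv_extend_of_card_eq (t := (Finset.univ : Finset (Fin k)))
    (by simp) (s := s) (f := f) (by intro a _; simp) hf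
  exact ⟨g.trans (Equiv.subtypeUnivEquiv (by simp)), hg⟩

lemma Fin.one_ne_zero_of_two_le [NeZero k] (hk : 2 ≤ k) : (1 : Fin k) ≠ 0 := by
  intro h
  have := congrArg Fin.val h
  rw [Fin.val_one', Fin.val_zero, Nat.mod_eq_of_lt (by omega)] at this
  exact one_ne_zero this

/-- Relabels the colours for the altered Latin rectangle. For `k = 2` the elements `-1` and `1`
coincide, but then `r ≠ q` forces `r = p`, so the last clause is vacuous. -/
lemma exists_perm_zero_one_neg_one [NeZero k] (hk : 2 ≤ k) {p q r : Fin k} (hpq : p ≠ q)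
    (hrq : r ≠ q) :
    ∃ m : Equiv.Perm (Fin k), m 0 = p ∧ m 1 = q ∧ (r ≠ p → m (-1) = r) := by
  classical
  have h10 := Fin.one_ne_zero_of_two_le hk
  by_cases hrp : r = p
  · obtain ⟨m, hm⟩ := exists_perm_extend (s := {0, 1}) (f := fun z : Fin k => if z = 0 then p else q)
      (by
        rintro a (rfl | rfl) b (rfl | rfl) <;> simp [h10, hpq, hpq.symm])
    exact ⟨m, by simp [hm 0], by simp [hm 1, h10], fun h => absurd hrp h⟩
  · have h3 : 3 ≤ k := by
      have := Finset.card_le_univ ({p, q, r} : Finset (Fin k))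
      rwa [Finset.card_eq_three.2 ⟨p, q, r, hpq, Ne.symm hrp, Ne.symm hrq, rfl⟩,
        Fintype.card_fin] at this
    have hn1 : (-1 : Fin k) ≠ 1 := by
      intro h
      have h2 : (1 : Fin k) + 1 = 0 := by
        nth_rewrite 1 [← h]; simp
      have := congrArg Fin.val h2
      rw [Fin.val_add, Fin.val_one', Fin.val_zero, Nat.mod_eq_of_lt (by omega : 1 < k),
        Nat.mod_eq_of_lt (by omega)] at this
      omega
    have hn0 : (-1 : Fin k) ≠ 0 := neg_ne_zero.2 h10
    obtain ⟨m, hm⟩ := exists_perm_extend (s := {0, 1, -1})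
      (f := fun z : Fin k => if z = 0 then p else if z = 1 then q else r) (by
        rintro a (rfl | rfl | rfl) b (rfl | rfl | rfl) <;>
          simp [h10, hn1, hpq, hpq.symm, hrp, Ne.symm hrp, hrq, Ne.symm hrq, eq_comm])
    refine ⟨m, ?_, ?_, fun _ => ?_⟩
    · rw [hm 0 (by simp)]; simp
    · rw [hm 1 (by simp)]; simp [h10]
    · rw [hm (-1) (by simp)]; simp only [hn0, hn1, if_false]

/-- Supplies the column shifts of the Latin rectangle: avoiding `0` makes every row miss its base
colour. -/
lemma exists_injective_nonzero [NeZero k] (hk : 2 ≤ k) (b₀ : Fin (k - 1)) :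
    ∃ τ : Fin (k - 1) → Fin k, Injective τ ∧ (∀ b, τ b ≠ 0) ∧ τ b₀ = 1 := by
  classical
  obtain ⟨g, hg⟩ := Set.MapsTo.exists_equiv_extend_of_card_eq
    (t := (Finset.univ.erase 0 : Finset (Fin k)))
    (by simp [Finset.card_erase_of_mem]) (s := {b₀}) (f := fun _ : Fin (k - 1) => (1 : Fin k))
    (by intro a _; simp [Fin.one_ne_zero_of_two_le hk]) (by simp)
  exact ⟨fun b => g b, Subtype.val_injective.comp g.injective,
    fun b => (Finset.mem_erase.1 (g b).2).1, hg _ rfl⟩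

end Permutations

/-! ### Meredith extensions preserve criticality -/

section Meredith

variable {V : Type u} {G : SimpleGraph V} {k : ℕ} {v : V} {u : G.neighborSet v ↪ Fin k}

/-- The colours at `v` are distinct, so `u x ↦ c v x` is a partial injection of `Fin k` and extends
to a permutation. -/
lemma exists_perm_apply_eq [NeZero k] {G' : SimpleGraph V} {c : V → V → Fin k}
    (hc : IsEdgeColoring G' c) (u : G.neighborSet v ↪ Fin k) :
    ∃ n : Equiv.Perm (Fin k), ∀ x (hx : G.Adj v x), G'.Adj v x → n (u ⟨x, hx⟩) = c v x := by
  classical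
  obtain ⟨n, hn⟩ := exists_perm_extend (s := u '' {x | G'.Adj v x})
    (f := extend u (fun x => c v x) 0) (by
      rintro _ ⟨x, hx, rfl⟩ _ ⟨y, hy, rfl⟩ h
      rw [u.injective.extend_apply, u.injective.extend_apply] at h
      rw [Subtype.ext (hc.2 _ _ _ hx hy h)])
  refine ⟨n, fun x hx hx' => ?_⟩
  rw [hn _ ⟨_, hx', rfl⟩, u.injective.extend_apply]

/-- A colouring of a subgraph of `G` extends over the copy of `K_{k,k-1}`. -/
lemma edgeColorable_of_isEdgeColoring [NeZero k] (hk : 2 ≤ k)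
    {M : SimpleGraph (({v}ᶜ : Set V) ⊕ (Fin k ⊕ Fin (k - 1)))} {G' : SimpleGraph V}
    (hM : M ≤ meredithGraph k G v u)
    (hG' : ∀ x y : ({v}ᶜ : Set V), M.Adj (Sum.inl x) (Sum.inl y) → G'.Adj x y)
    (hv : ∀ (x : ({v}ᶜ : Set V)) a, M.Adj (Sum.inl x) (Sum.inr (Sum.inl a)) → G'.Adj v x)
    (h : EdgeColorable G' k) : EdgeColorable M k := by
  obtain ⟨c, hc⟩ := h
  obtain ⟨n, hn⟩ := exists_perm_apply_eq hc u
  obtain ⟨τ, hτ, hτ0, -⟩ := exists_injective_nonzero hk ⟨0, by omega⟩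
  -- Row `a` misses `n a` because `τ` avoids `0`; rows and columns have no repetition because `τ`
  -- and `n` are injective.
  refine edgeColorable_of_le_meredithGraph (R := fun _ _ => True) hM hG' hv (fun _ _ _ => trivial)
    c (fun a b => n a + τ b) hc.1 (fun x _ => hc.2 x) ?_ ?_ ?_
  · intro a b b' _ _ h
    exact hτ (add_left_cancel h)
  · intro a a' b _ _ h
    exact n.injective (add_right_cancel h)
  · intro x hx hx' b _ h
    rw [← hn x hx hx'] at h
    exact hτ0 b (left_eq_add.1 h)

/-- Without the edge `vi`, the vertex `i` has degree below `k` and misses some colour. If `v` missed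
it too, `vi` could be coloured with it; hence it occurs on an edge `vj`. -/
lemma exists_adj_missing_color [Finite V] {i : V} (hvi : G.Adj v i)
    (hdeg : (G.neighborSet i).ncard ≤ k) (hG : ¬ EdgeColorable G k) {c : V → V → Fin k}
    (hc : IsEdgeColoring (G.deleteEdges {s(v, i)}) c) :
    ∃ j, (G.deleteEdges {s(v, i)}).Adj v j ∧
      ∀ y, (G.deleteEdges {s(v, i)}).Adj i y → c i y ≠ c v j := by
  classical
  obtain ⟨q, hq⟩ : ∃ q, q ∉ c i '' ((G.neighborSet i) \ {v}) := by
    by_contra! h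
    have h1 : c i '' ((G.neighborSet i) \ {v}) = Set.univ := Set.eq_univ_of_forall h
    have h2 := Set.ncard_image_le (f := c i) (Set.toFinite ((G.neighborSet i) \ {v}))
    have h3 := Set.ncard_sdiff_singleton_lt_of_mem (s := G.neighborSet i) (a := v) hvi.symm
      (Set.toFinite _)
    rw [h1, Set.ncard_univ, Nat.card_fin] at h2
    omega
  have hqi : ∀ y, (G.deleteEdges {s(v, i)}).Adj i y → c i y ≠ q := by
    intro y hy h
    rw [SimpleGraph.deleteEdges_adj] at hy
    refine hq ⟨y, ⟨hy.1, ?_⟩, h⟩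
    rintro rfl
    exact hy.2 Sym2.eq_swap
  by_contra! hno
  refine hG (hc.edgeColorable_of_missing (x := q) ?_ hqi)
  rintro y hy rfl
  obtain ⟨z, hz, hz'⟩ := hno y hy
  exact hqi z hz hz'

/-- Give `vi` the colour of `vj` from `exists_adj_missing_color`. This is proper except at `v`,
where it does no harm since `v` is split into distinct left vertices. The row of `u i` must now miss
that colour instead of its base colour, which is achieved by changing its entry in column `b₀`. The
change creates at most one repetition in that column, and the deleted edge removes it. -/
lemma edgeColorable_deleteEdges_left_right [Finite V] (hk : 2 ≤ k) (hG : ¬ EdgeColorable G k)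
    {i : V} (hvi : G.Adj v i) (hdeg : (G.neighborSet i).ncard ≤ k)
    (hcol : EdgeColorable (G.deleteEdges {s(v, i)}) k) {a₀ : Fin k} (b₀ : Fin (k - 1))
    (ha₀ : a₀ = u ⟨i, hvi⟩ ∨ a₀ ∉ Set.range u) :
    EdgeColorable ((meredithGraph k G v u).deleteEdges
      {s(Sum.inr (Sum.inl a₀), Sum.inr (Sum.inr b₀))}) k := by
  classical
  have : NeZero k := ⟨by omega⟩
  obtain ⟨c, hc⟩ := hcol
  obtain ⟨j, hj, hmiss⟩ := exists_adj_missing_color hvi hdeg hG hc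
  obtain ⟨n, hn⟩ := exists_perm_apply_eq hc u
  have hadj : ∀ {x y}, G.Adj x y → s(x, y) ≠ s(v, i) → (G.deleteEdges {s(v, i)}).Adj x y := by
    intro x y h h'
    rw [SimpleGraph.deleteEdges_adj]; exact ⟨h, h'⟩
  obtain ⟨hvj, hji⟩ := (SimpleGraph.deleteEdges_adj).1 hj
  have hij : i ≠ j := by rintro rfl; exact hji rfl
  have huij : u ⟨i, hvi⟩ ≠ u ⟨j, hvj⟩ := fun h => hij (congrArg Subtype.val (u.injective h))
  have ha₀j : a₀ ≠ u ⟨j, hvj⟩ := by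
    rcases ha₀ with rfl | h
    · exact huij
    · rintro rfl; exact h ⟨_, rfl⟩
  obtain ⟨m, hm0, hm1, hm2⟩ := exists_perm_zero_one_neg_one hk (n.injective.ne huij)
    (n.injective.ne ha₀j)
  obtain ⟨τ, hτ, hτ0, hτ1⟩ := exists_injective_nonzero hk b₀
  have hmi : m.symm (n (u ⟨i, hvi⟩)) = 0 := by rw [← hm0, Equiv.symm_apply_apply]
  have hL : ∀ {x y : Fin k}, m x = m y → x = y := fun h => m.injective h
  refine edgeColorable_of_le_meredithGraph (G' := G) (R := fun a b => ¬ (a = a₀ ∧ b = b₀))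
    (SimpleGraph.deleteEdges_le _) ?_ ?_ ?_
    (fun x y => if s(x, y) = s(v, i) then c v j else c x y)
    -- Here `m 0` and `m 1` are the base colours of the rows `u i` and `u j`. As `τ b₀ = 1`, the
    -- unaltered entry of row `u i` in column `b₀` is `m 1`; replacing it by `m 0` makes this row
    -- miss `m 1`, the new colour of `vi`.
    (fun a b => if a = u ⟨i, hvi⟩ ∧ b = b₀ then m 0 else m (m.symm (n a) + τ b)) ?_ ?_ ?_ ?_ ?_
  · intro x y h
    simpa using (SimpleGraph.deleteEdges_le _) h
  · intro x a h
    have := (SimpleGraph.deleteEdges_le _) h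
    rw [meredithGraph_adj_inl_inr_inl] at this
    exact this.1
  · rintro a b h ⟨rfl, rfl⟩
    simp at h
  · intro x y hxy
    have : s(y, x) = s(x, y) := Sym2.eq_swap
    simp only [this]
    split_ifs with h
    · rfl
    · exact hc.1 _ _ (hadj hxy h)
  · intro x hx y y' hy hy' hcc
    have hx' : ∀ z, s(x, z) = s(v, i) → x = i ∧ z = v := by
      intro z hz
      rcases Sym2.eq_iff.1 hz with ⟨h, -⟩ | h
      · exact absurd h hx
      · exact h
    by_cases h : s(x, y) = s(v, i) <;> by_cases h' : s(x, y') = s(v, i)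
    · exact (hx' _ h).2.trans (hx' _ h').2.symm
    · simp only [h, h', if_true, if_false] at hcc
      obtain ⟨rfl, -⟩ := hx' _ h
      exact absurd hcc.symm (hmiss _ (hadj hy' h'))
    · simp only [h, h', if_true, if_false] at hcc
      obtain ⟨rfl, -⟩ := hx' _ h'
      exact absurd hcc (hmiss _ (hadj hy h))
    · simp only [h, h', if_false] at hcc
      exact hc.2 _ _ _ (hadj hy h) (hadj hy' h') hcc
  · intro a b b' _ _ hcc
    by_cases ha : a = u ⟨i, hvi⟩
    · subst ha
      by_cases hb : b = b₀ <;> by_cases hb' : b' = b₀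
      · rw [hb, hb']
      · simp only [hb, hb', and_self, and_false, if_true, if_false, hmi, zero_add] at hcc
        exact absurd (hL hcc).symm (hτ0 _)
      · simp only [hb, hb', and_self, and_false, if_true, if_false, hmi, zero_add] at hcc
        exact absurd (hL hcc) (hτ0 _)
      · simp only [hb, hb', and_false, if_false] at hcc
        exact hτ (add_left_cancel (hL hcc))
    · simp only [ha, false_and, if_false] at hcc
      exact hτ (add_left_cancel (hL hcc))
  -- In column `b₀` the colour `m 0` also occurs in the row with base colour `m (-1)`. If `a₀ ≠ u
  -- i`, that row is `a₀` by the choice of `m`, and its entry is deleted; if `a₀ = u i`, the altered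
  -- entry itself is deleted.
  · have key : ∀ a, ¬ (a = a₀ ∧ b₀ = b₀) → ¬ (u ⟨i, hvi⟩ = a₀ ∧ b₀ = b₀) →
        m 0 ≠ m (m.symm (n a) + τ b₀) := by
      intro a ha hi h
      rw [hτ1] at h
      have h1 : m.symm (n a) = -1 := eq_neg_of_add_eq_zero_left (hL h).symm
      have h2 : n a₀ ≠ n (u ⟨i, hvi⟩) := fun h => hi ⟨(n.injective h).symm, rfl⟩
      rw [Equiv.symm_apply_eq, hm2 h2] at h1
      exact ha ⟨n.injective h1, rfl⟩
    intro a a' b hR hR' hcc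
    by_cases hb : b = b₀
    · subst hb
      by_cases ha : a = u ⟨i, hvi⟩ <;> by_cases ha' : a' = u ⟨i, hvi⟩
      · rw [ha, ha']
      · subst ha
        simp only [ha', and_true, if_true, if_false] at hcc
        exact absurd hcc (key _ hR' hR)
      · subst ha'
        simp only [ha, and_true, if_true, if_false] at hcc
        exact absurd hcc.symm (key _ hR hR')
      · simp only [ha, ha', false_and, if_false] at hcc
        exact n.injective (m.symm.injective (add_right_cancel (hL hcc)))
    · simp only [hb, and_false, if_false] at hcc
      exact n.injective (m.symm.injective (add_right_cancel (hL hcc)))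
  · intro x hx _ b hR hcc
    by_cases hxi : x = i
    · subst hxi
      rw [if_pos rfl, ← hn j hvj hj, ← hm1] at hcc
      by_cases hb : b = b₀
      · simp only [hb, and_self, if_true] at hcc
        exact Fin.one_ne_zero_of_two_le hk (hL hcc)
      · simp only [hb, and_false, if_false, hmi, zero_add] at hcc
        exact hb (hτ ((hL hcc).symm.trans hτ1.symm))
    · have hs : s(v, x) ≠ s(v, i) := fun h => hxi (Sym2.congr_right.1 h)
      have hu : u ⟨x, hx⟩ ≠ u ⟨i, hvi⟩ := fun h => hxi (congrArg Subtype.val (u.injective h))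
      simp only [hs, hu, false_and, if_false] at hcc
      rw [← hn x hx (hadj hx hs), ← Equiv.symm_apply_eq] at hcc
      exact hτ0 b (left_eq_add.1 hcc)

/-- Meredith extensions preserve criticality. -/
lemma IsCritical.meredithGraph [Fintype V] [Fintype ({v}ᶜ : Set V)] (hk : 2 ≤ k)
    (hG : IsCritical k G) (hv : ∃ w, G.Adj v w) : IsCritical k (meredithGraph k G v u) := by
  have : NeZero k := ⟨by omega⟩
  rw [isCritical_iff hk] at hG ⊢
  obtain ⟨⟨hdeg, -⟩, hG, hdel⟩ := hG
  refine ⟨⟨?_, Sum.inr (Sum.inr ⟨0, by omega⟩), ncard_neighborSet_right _⟩,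
    fun h => hG h.of_meredithGraph, ?_⟩
  · rintro (x | a)
    · rw [ncard_neighborSet_inl]; exact hdeg x
    · exact ncard_neighborSet_inr_le a
  have h0 : ∀ (x y : ({v}ᶜ : Set V)), G.Adj x y → EdgeColorable
      ((CriticalGraphs.meredithGraph k G v u).deleteEdges {s(Sum.inl x, Sum.inl y)}) k := by
    intro x y hxy
    refine edgeColorable_of_isEdgeColoring hk (SimpleGraph.deleteEdges_le _) ?_ ?_ (hdel x y hxy)
    · intro x' y' h
      rw [SimpleGraph.deleteEdges_adj] at h ⊢
      refine ⟨by simpa using h.1, fun h' => h.2 ?_⟩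
      have h1 : s((x' : V), (y' : V)) = s((x : V), (y : V)) := h'
      rw [Sym2.eq_iff, ← Subtype.ext_iff, ← Subtype.ext_iff, ← Subtype.ext_iff,
        ← Subtype.ext_iff] at h1
      rcases h1 with ⟨rfl, rfl⟩ | ⟨rfl, rfl⟩
      · exact Set.mem_singleton _
      · exact Sym2.eq_swap
    · intro x' a h
      rw [SimpleGraph.deleteEdges_adj] at h ⊢
      rw [meredithGraph_adj_inl_inr_inl] at h
      refine ⟨h.1.1, fun h' => ?_⟩
      rcases Sym2.eq_iff.1 (Set.mem_singleton_iff.1 h') with ⟨h1, -⟩ | ⟨h1, -⟩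
      · exact x.2 h1.symm
      · exact y.2 h1.symm
  have h1 : ∀ (x : ({v}ᶜ : Set V)) (hx : G.Adj v x), EdgeColorable
      ((CriticalGraphs.meredithGraph k G v u).deleteEdges
        {s(Sum.inl x, Sum.inr (Sum.inl (u ⟨x, hx⟩)))}) k := by
    intro x hx
    refine edgeColorable_of_isEdgeColoring hk (SimpleGraph.deleteEdges_le _) ?_ ?_ (hdel v x hx)
    · intro x' y' h
      rw [SimpleGraph.deleteEdges_adj] at h ⊢
      refine ⟨by simpa using h.1, fun h' => ?_⟩
      rcases Sym2.eq_iff.1 (Set.mem_singleton_iff.1 h') with ⟨h1, -⟩ | ⟨-, h1⟩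
      · exact x'.2 h1
      · exact y'.2 h1
    · intro x' a h
      rw [SimpleGraph.deleteEdges_adj] at h ⊢
      obtain ⟨h, hne⟩ := h
      rw [meredithGraph_adj_inl_inr_inl] at h
      obtain ⟨hx', rfl⟩ := h
      refine ⟨hx', fun h' => hne ?_⟩
      obtain rfl : x' = x := Subtype.ext (Sym2.congr_right.1 (Set.mem_singleton_iff.1 h'))
      rfl
  have h2 : ∀ (a : Fin k) (b : Fin (k - 1)), EdgeColorable
      ((CriticalGraphs.meredithGraph k G v u).deleteEdges
        {s(Sum.inr (Sum.inl a), Sum.inr (Sum.inr b))}) k := by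
    intro a b
    by_cases ha : a ∈ Set.range u
    · obtain ⟨⟨i, hi⟩, rfl⟩ := ha
      exact edgeColorable_deleteEdges_left_right hk hG hi (hdeg i) (hdel v i hi) b (Or.inl rfl)
    -- For an unmatched left vertex any neighbour of `v` serves; this is where `v` must not be
    -- isolated.
    · obtain ⟨i, hi⟩ := hv
      exact edgeColorable_deleteEdges_left_right hk hG hi (hdeg i) (hdel v i hi) b (Or.inr ha)
  rintro (x | a | b) (y | a' | b') h
  · exact h0 x y (by simpa using h)
  · rw [meredithGraph_adj_inl_inr_inl] at h
    obtain ⟨hx, rfl⟩ := h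
    exact h1 x hx
  · exact absurd h (by simp)
  · rw [meredithGraph_adj_inr_inl_inl] at h
    obtain ⟨hx, rfl⟩ := h
    rw [Sym2.eq_swap]
    exact h1 y hx
  · exact absurd h (by simp)
  · exact h2 a b'
  · exact absurd h (by simp)
  · rw [Sym2.eq_swap]
    exact h2 a' b
  · exact absurd h (by simp)

end Meredith

/-! ### Path systems -/

/-- Lists `l v i`, for `v` of degree `k - 1`, such that the sequences `v :: l v i` are the vertex
sequences of distinguished paths; the length of `l v i` falls short of `N` by at most `r v`. -/
structure IsPathSystem {V : Type u} (G : SimpleGraph V) (k N : ℕ) (r : V → ℕ)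
    (l : V → Fin (k - 1) → List V) : Prop where
  isChain : ∀ v, (G.neighborSet v).ncard = k - 1 → ∀ i, (v :: l v i).IsChain G.Adj
  nodup : ∀ v, (G.neighborSet v).ncard = k - 1 → ∀ i, (l v i).Nodup
  ncard_ne : ∀ v, (G.neighborSet v).ncard = k - 1 → ∀ i, ∀ x ∈ l v i,
    (G.neighborSet x).ncard ≠ k - 1
  length : ∀ v, (G.neighborSet v).ncard = k - 1 → ∀ i, N ≤ (l v i).length + r v
  disjoint : ∀ v, (G.neighborSet v).ncard = k - 1 → ∀ i j, i ≠ j → (l v i).Disjoint (l v j)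
  disjoint_of_ne : ∀ v, (G.neighborSet v).ncard = k - 1 → ∀ w, (G.neighborSet w).ncard = k - 1 →
    w ≠ v → ∀ i j, (l v i).Disjoint (l w j)

lemma exists_walk_of_isChain {V : Type u} {G : SimpleGraph V} (l : List V) :
    ∀ v, (v :: l).IsChain G.Adj → ∃ z, ∃ p : G.Walk v z, p.support = v :: l := by
  induction l with
  | nil => exact fun v _ => ⟨v, .nil, rfl⟩
  | cons a l ih =>
    intro v h
    rw [List.isChain_cons_cons] at h
    obtain ⟨z, p, hp⟩ := ih a h.2
    exact ⟨z, .cons h.1 p, by simp [hp]⟩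

lemma IsPathSystem.hasDistinguishedPaths {V : Type u} [Fintype V] {G : SimpleGraph V} {k t : ℕ}
    {r : V → ℕ} {l : V → Fin (k - 1) → List V}
    (h : IsPathSystem G k (2 * t * (k - 1) + 1) r l) (hr : ∀ v, r v = 0) :
    HasDistinguishedPaths k t G := by
  classical
  have hdeg : ∀ x, x ∈ degreeSet G (k - 1) ↔ (G.neighborSet x).ncard = k - 1 := by
    intro x
    rw [← degree_eq_ncard]
    exact Iff.rfl
  have hex : ∀ (v : V) (i : Fin (k - 1)), ∃ z, ∃ p : G.Walk v z,
      (G.neighborSet v).ncard = k - 1 → p.support = v :: l v i := by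
    intro v i
    by_cases hv : (G.neighborSet v).ncard = k - 1
    · obtain ⟨z, p, hp⟩ := exists_walk_of_isChain _ v (h.isChain v hv i)
      exact ⟨z, p, fun _ => hp⟩
    · exact ⟨v, .nil, fun h => absurd h hv⟩
  choose z p hp using hex
  have hmem : ∀ v, (G.neighborSet v).ncard = k - 1 → ∀ i x,
      x ∈ walkVerts (p v i) ↔ x = v ∨ x ∈ l v i := by
    intro v hv i x
    change x ∈ (p v i).support ↔ _
    rw [hp v i hv, List.mem_cons]
  have hnodup : ∀ v, (G.neighborSet v).ncard = k - 1 → ∀ i, (p v i).support.Nodup := by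
    intro v hv i
    rw [hp v i hv, List.nodup_cons]
    exact ⟨fun hm => h.ncard_ne v hv i v hm hv, h.nodup v hv i⟩
  refine ⟨z, p, fun v hv => ?_⟩
  rw [hdeg] at hv
  refine ⟨fun i => SimpleGraph.Walk.IsPath.mk' (hnodup v hv i), fun i => ?_, fun i => ?_, fun i j hij => ?_, ?_⟩
  · ext x
    rw [Set.mem_inter_iff, hmem v hv, hdeg, Set.mem_singleton_iff]
    constructor
    · rintro ⟨rfl | hx, hx'⟩
      · rfl
      · exact absurd hx' (h.ncard_ne v hv i x hx)
    · rintro rfl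
      exact ⟨Or.inl rfl, hv⟩
  · have : walkVerts (p v i) = ((p v i).support.toFinset : Set V) := by
      ext x
      simp [walkVerts]
    rw [this, Set.ncard_coe_finset, List.toFinset_card_of_nodup (hnodup v hv i), hp v i hv,
      List.length_cons]
    -- The initial vertex `v` is not in the list, so it contributes one vertex more.
    have := h.length v hv i
    rw [hr] at this
    omega
  · ext x
    rw [Set.mem_inter_iff, hmem v hv, hmem v hv, Set.mem_singleton_iff]
    constructor
    · rintro ⟨hx | hx, hx' | hx'⟩
      · exact hx
      · exact hx
      · exact hx'
      · exact absurd hx' (h.disjoint v hv i j hij hx)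
    · rintro rfl
      exact ⟨Or.inl rfl, Or.inl rfl⟩
  · intro w hw hwv i j
    rw [hdeg] at hw
    ext x
    rw [Set.mem_inter_iff, hmem v hv, hmem w hw]
    refine iff_of_false ?_ (Set.notMem_empty x)
    rintro ⟨rfl | hx, rfl | hx'⟩
    · exact hwv rfl
    · exact h.ncard_ne w hw j _ hx' hv
    · exact h.ncard_ne v hv i _ hx hw
    · exact h.disjoint_of_ne v hv w hw hwv i j hx hx'

/-! ### Lengthening paths by a Meredith extension -/

section Meredith

variable {V : Type u} {G : SimpleGraph V} {k : ℕ} {v : V} {u : G.neighborSet v ↪ Fin k}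

/-- The termination measure for both sequences of extensions: `r` is the degree deficit in one and
the path-length deficit in the other. -/
lemma sum_lt_sum_of_inl_le [Fintype V] [Fintype ({v}ᶜ : Set V)] {β : Type*} [Fintype β]
    {r : V → ℕ} {r' : ({v}ᶜ : Set V) ⊕ β → ℕ} (h : ∀ x : ({v}ᶜ : Set V), r' (Sum.inl x) ≤ r x)
    (hv : ∑ b, r' (Sum.inr b) < r v) : ∑ x, r' x < ∑ x, r x := by
  classical
  rw [Fintype.sum_sum_type, Fintype.sum_eq_add_sum_compl v, add_comm]
  refine add_lt_add_of_lt_of_le hv ?_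
  rw [Finset.sum_subtype ({v}ᶜ : Finset V) (p := fun x => x ∈ ({v}ᶜ : Set V)) (by simp)]
  exact Finset.sum_le_sum fun x _ => h x

/-- A Meredith extension at a vertex `v` of degree `k - 1` lengthens the paths of `v`. -/
lemma IsPathSystem.meredithGraph [Fintype V] [Fintype ({v}ᶜ : Set V)] {N : ℕ} {r : V → ℕ}
    {l : V → Fin (k - 1) → List V} (h : IsPathSystem G k N r l) (hk : 2 ≤ k)
    (hv : (G.neighborSet v).ncard = k - 1) (hrv : r v ≠ 0) :
    ∃ r' l', IsPathSystem (meredithGraph k G v u) k N r' l' ∧ ∑ x, r' x < ∑ x, r x := by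
  classical
  have hcard : Fintype.card (G.neighborSet v) = k - 1 := by
    rw [← hv, Set.ncard_eq_toFinset_card', Set.toFinset_card]
  obtain ⟨a, ha⟩ : ∃ a, a ∉ Set.range u := by
    by_contra! hsurj
    have := Fintype.card_le_of_surjective u hsurj
    rw [hcard, Fintype.card_fin] at this
    omega
  have ha_unique : ∀ a', a' ∉ Set.range u → a' = a := by
    intro a' ha'
    by_contra hne
    have h1 : Finset.univ.image u ⊆ (Finset.univ.erase a).erase a' := by
      intro z hz
      obtain ⟨b, -, rfl⟩ := Finset.mem_image.1 hz
      simp only [Finset.mem_erase, Finset.mem_univ, and_true]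
      exact ⟨fun h => ha' ⟨b, h⟩, fun h => ha ⟨b, h⟩⟩
    have h2 := Finset.card_le_card h1
    rw [Finset.card_image_of_injective _ u.injective, Finset.card_erase_of_mem (by simp [hne]),
      Finset.card_erase_of_mem (by simp), Finset.card_univ, hcard, Finset.card_univ,
      Fintype.card_fin] at h2
    omega
  -- The unmatched left vertex `a` replaces `v`; under `f` the vertices of degree `k - 1` of the two
  -- graphs correspond.
  let f : V → ({v}ᶜ : Set V) ⊕ (Fin k ⊕ Fin (k - 1)) := fun y =>
    if hy : y = v then Sum.inr (Sum.inl a) else Sum.inl ⟨y, hy⟩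
  have hfv : f v = Sum.inr (Sum.inl a) := by simp [f]
  have hfne : ∀ y (hy : y ≠ v), f y = Sum.inl ⟨y, hy⟩ := fun y hy => by simp [f, hy]
  have hfinl : ∀ x : ({v}ᶜ : Set V), Sum.inl x = f x := fun x => (hfne x x.2).symm
  have hf : Injective f := by
    intro y z hyz
    by_cases hy : y = v <;> by_cases hz : z = v
    · rw [hy, hz]
    · rw [hy, hfv, hfne z hz] at hyz
      exact absurd hyz (by simp)
    · rw [hz, hfv, hfne y hy] at hyz
      exact absurd hyz (by simp)
    · rw [hfne y hy, hfne z hz] at hyz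
      exact congrArg Subtype.val (Sum.inl_injective hyz)
  have hfr : ∀ y b, f y ≠ Sum.inr (Sum.inr b) := by
    intro y b
    by_cases hy : y = v
    · rw [hy, hfv]; simp
    · rw [hfne y hy]; simp
  have hfl : ∀ y x, f y ≠ Sum.inr (Sum.inl (u x)) := by
    intro y x
    by_cases hy : y = v
    · rw [hy, hfv]
      intro h
      exact ha ⟨x, (Sum.inl_injective (Sum.inr_injective h)).symm⟩
    · rw [hfne y hy]; simp
  have hfadj : ∀ {x y}, x ≠ v → y ≠ v → G.Adj x y →
      (CriticalGraphs.meredithGraph k G v u).Adj (f x) (f y) := by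
    intro x y hx hy hxy
    rw [hfne x hx, hfne y hy]
    simpa using hxy
  have hfdeg : ∀ x, ((CriticalGraphs.meredithGraph k G v u).neighborSet (f x)).ncard = k - 1 ↔
      (G.neighborSet x).ncard = k - 1 := by
    intro x
    by_cases hx : x = v
    · rw [hx, hfv, ncard_neighborSet_left_of_notMem ha]
      exact iff_of_true rfl hv
    · rw [hfne x hx, ncard_neighborSet_inl]
  have hdeg : ∀ p, ((CriticalGraphs.meredithGraph k G v u).neighborSet p).ncard = k - 1 →
      ∃ x, (G.neighborSet x).ncard = k - 1 ∧ f x = p := by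
    rintro (x | a' | b) hp
    · rw [hfinl] at hp ⊢
      exact ⟨x, (hfdeg x).1 hp, rfl⟩
    · by_cases ha' : a' ∈ Set.range u
      · rw [ncard_neighborSet_left_of_mem ha'] at hp
        omega
      · exact ⟨v, hv, by rw [hfv, ha_unique a' ha']⟩
    · rw [ncard_neighborSet_right] at hp
      omega
  -- Since `v` itself has degree `k - 1`, no list passes through it, so `f` carries the lists to
  -- chains of the extension.
  have hlv : ∀ x, (G.neighborSet x).ncard = k - 1 → ∀ i, ∀ y ∈ l x i, y ≠ v := by
    rintro x hx i y hy rfl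
    exact h.ncard_ne x hx i y hy hv
  -- The first vertices of the nonempty lists at `v` are distinct neighbours of `v`. Extending to a
  -- bijection also assigns a neighbour, hence a matched left vertex, to every index whose list is
  -- empty.
  obtain ⟨g, hg⟩ := Finset.exists_equiv_extend_of_card_eq
    (α := Fin (k - 1)) (t := (G.neighborSet v).toFinset)
    (by rw [Set.toFinset_card, hcard, Fintype.card_fin])
    (s := Finset.univ.filter fun i => l v i ≠ []) (f := fun i => (l v i).headD v) (by
      intro y hy
      obtain ⟨i, hi, rfl⟩ := Finset.mem_image.1 hy
      obtain ⟨y, m, hm⟩ := List.exists_cons_of_ne_nil (Finset.mem_filter.1 hi).2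
      have := h.isChain v hv i
      rw [hm, List.isChain_cons_cons] at this
      simpa [hm] using this.1) (by
      intro i hi j hj hij
      obtain ⟨y, m, hm⟩ := List.exists_cons_of_ne_nil (Finset.mem_filter.1 hi).2
      obtain ⟨y', m', hm'⟩ := List.exists_cons_of_ne_nil (Finset.mem_filter.1 hj).2
      by_contra hne
      simp only [hm, hm', List.headD_cons] at hij
      subst hij
      exact h.disjoint v hv i j hne (a := y) (by simp [hm]) (by simp [hm']))
  have hgv : ∀ i, G.Adj v (g i) := fun i => Set.mem_toFinset.1 (g i).2
  let e : Fin (k - 1) → Fin k := fun i => u ⟨g i, hgv i⟩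
  have he : Injective e := fun i j hij => by
    have hij' := congrArg Subtype.val (u.injective hij)
    exact g.injective (Subtype.ext hij')
  -- The new path runs from `a` to right vertex `i`, on to the left vertex matched to `g i`, and
  -- then along the old list. Both inserted vertices have degree `k`.
  let l' : (({v}ᶜ : Set V) ⊕ (Fin k ⊕ Fin (k - 1))) → Fin (k - 1) →
      List (({v}ᶜ : Set V) ⊕ (Fin k ⊕ Fin (k - 1))) := fun p i =>
    match p with
    | Sum.inl x => (l x i).map f
    | Sum.inr _ => Sum.inr (Sum.inr i) :: Sum.inr (Sum.inl (e i)) :: (l v i).map f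
  -- The paths gain two vertices, but lowering the deficit by one suffices for the descent.
  let r' : (({v}ᶜ : Set V) ⊕ (Fin k ⊕ Fin (k - 1))) → ℕ := fun p =>
    match p with
    | Sum.inl x => r x
    | Sum.inr (Sum.inl a') => if a' = a then r v - 1 else 0
    | Sum.inr (Sum.inr _) => 0
  have hl'v : ∀ i, l' (f v) i =
      Sum.inr (Sum.inr i) :: Sum.inr (Sum.inl (e i)) :: (l v i).map f := fun i => by rw [hfv]
  have hl'ne : ∀ x, x ≠ v → ∀ i, l' (f x) i = (l x i).map f := fun x hx i => by rw [hfne x hx]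
  have hmem : ∀ x i p, p ∈ l' (f x) i → (∃ y ∈ l x i, f y = p) ∨
      (x = v ∧ (p = Sum.inr (Sum.inr i) ∨ p = Sum.inr (Sum.inl (e i)))) := by
    intro x i p hp
    by_cases hx : x = v
    · subst hx
      rw [hl'v, List.mem_cons, List.mem_cons, List.mem_map] at hp
      rcases hp with hp | hp | hp
      · exact Or.inr ⟨rfl, Or.inl hp⟩
      · exact Or.inr ⟨rfl, Or.inr hp⟩
      · exact Or.inl hp
    · rw [hl'ne x hx, List.mem_map] at hp
      exact Or.inl hp
  refine ⟨r', l', ⟨?_, ?_, ?_, ?_, ?_, ?_⟩, ?_⟩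
  · intro p hp i
    obtain ⟨x, hx, rfl⟩ := hdeg p hp
    by_cases hxv : x = v
    · subst hxv
      rw [hl'v, hfv, List.isChain_cons_cons, List.isChain_cons_cons]
      refine ⟨by simp, by simp, ?_⟩
      have hc := h.isChain x hx i
      have hh := hg i
      have hne := hlv x hx i
      cases hl : l x i with
      | nil => simp
      | cons y m =>
        rw [hl] at hc hne hh
        simp only [Finset.mem_filter, Finset.mem_univ, true_and, ne_eq, hl, reduceCtorEq,
          not_false_eq_true, List.headD_cons, forall_const] at hh
        rw [List.map_cons, List.isChain_cons_cons]
        refine ⟨?_, ?_⟩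
        · rw [hfne y (hne y (by simp)), meredithGraph_adj_inr_inl_inl]
          exact ⟨hh ▸ hgv i, by simp only [e, hh]⟩
        · rw [← List.map_cons, List.isChain_map]
          rw [List.isChain_cons_cons] at hc
          exact hc.2.imp_of_mem_imp fun _ _ hb hb' hab => hfadj (hne _ hb) (hne _ hb') hab
    · rw [hl'ne x hxv, ← List.map_cons, List.isChain_map]
      have hne : ∀ y ∈ x :: l x i, y ≠ v := by
        intro y hy
        rcases List.mem_cons.1 hy with rfl | hy
        · exact hxv
        · exact hlv x hx i y hy
      exact (h.isChain x hx i).imp_of_mem_imp fun _ _ hb hb' hab =>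
        hfadj (hne _ hb) (hne _ hb') hab
  · intro p hp i
    obtain ⟨x, hx, rfl⟩ := hdeg p hp
    have hm := (h.nodup x hx i).map hf
    by_cases hxv : x = v
    · subst hxv
      rw [hl'v, List.nodup_cons, List.nodup_cons]
      refine ⟨?_, ?_, hm⟩
      · simp [hfr]
      · rw [List.mem_map]
        rintro ⟨y, -, hy⟩
        exact hfl _ _ hy
    · rwa [hl'ne x hxv]
  · intro p hp i q hq
    obtain ⟨x, hx, rfl⟩ := hdeg p hp
    rcases hmem x i q hq with ⟨y, hy, rfl⟩ | ⟨-, rfl | rfl⟩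
    · rw [Ne, hfdeg]
      exact h.ncard_ne x hx i y hy
    · rw [ncard_neighborSet_right]; omega
    · rw [ncard_neighborSet_left_of_mem ⟨_, rfl⟩]; omega
  · intro p hp i
    obtain ⟨x, hx, rfl⟩ := hdeg p hp
    have := h.length x hx i
    by_cases hxv : x = v
    · subst hxv
      rw [hl'v, hfv]
      simp only [List.length_cons, List.length_map, r', if_true]
      omega
    · rw [hl'ne x hxv, hfne x hxv, List.length_map]
      exact this
  · intro p hp i j hij q hq hq'
    obtain ⟨x, hx, rfl⟩ := hdeg p hp
    rcases hmem x i q hq with ⟨y, hy, rfl⟩ | ⟨-, rfl | rfl⟩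
    · rcases hmem x j _ hq' with ⟨z, hz, hyz⟩ | ⟨-, hyz | hyz⟩
      · rw [hf hyz] at hz
        exact h.disjoint x hx i j hij hy hz
      · exact hfr _ _ hyz
      · exact hfl _ _ hyz
    · rcases hmem x j _ hq' with ⟨z, hz, hyz⟩ | ⟨-, hyz | hyz⟩
      · exact hfr _ _ hyz
      · exact hij (Sum.inr_injective (Sum.inr_injective hyz))
      · simp at hyz
    · rcases hmem x j _ hq' with ⟨z, hz, hyz⟩ | ⟨-, hyz | hyz⟩
      · exact hfl _ _ hyz
      · simp at hyz
      · exact hij (he (Sum.inl_injective (Sum.inr_injective hyz)))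
  · intro p hp p' hp' hne i j q hq hq'
    obtain ⟨x, hx, rfl⟩ := hdeg p hp
    obtain ⟨x', hx', rfl⟩ := hdeg p' hp'
    have hxx' : x' ≠ x := fun h => hne (congrArg f h)
    rcases hmem x i q hq with ⟨y, hy, rfl⟩ | ⟨hxv, hq⟩
    · rcases hmem x' j _ hq' with ⟨z, hz, hyz⟩ | ⟨-, hyz | hyz⟩
      · rw [hf hyz] at hz
        exact h.disjoint_of_ne x hx x' hx' hxx' i j hy hz
      · exact hfr _ _ hyz
      · exact hfl _ _ hyz
    · rcases hmem x' j _ hq' with ⟨z, hz, rfl⟩ | ⟨hxv', -⟩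
      · rcases hq with hq | hq
        · exact hfr _ _ hq
        · exact hfl _ _ hq
      · exact hxx' (hxv'.trans hxv.symm)
  · refine sum_lt_sum_of_inl_le (v := v) (fun x => le_rfl) ?_
    rw [Fintype.sum_sum_type]
    simp only [r', Finset.sum_ite_eq', Finset.mem_univ, if_true, Finset.sum_const_zero, add_zero]
    omega

lemma exists_adj_meredithGraph (hk : 2 ≤ k) (hG : ∀ x, ∃ y, G.Adj x y) [Finite V] :
    ∀ x, ∃ y, (meredithGraph k G v u).Adj x y := by
  intro x
  suffices h : ((meredithGraph k G v u).neighborSet x).ncard ≠ 0 from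
    Set.nonempty_of_ncard_ne_zero h
  rcases x with x | a
  · rw [ncard_neighborSet_inl]
    obtain ⟨y, hy⟩ := hG x
    exact Set.ncard_ne_zero_of_mem (a := y) hy
  · have := le_ncard_neighborSet_inr (u := u) a
    omega

end Meredith

/-! ### Iterating Meredith extensions -/

section Sequences

variable {k : ℕ}

lemma exists_isMeredithExtension (hk : 2 ≤ k) {G : FinGraph.{u}} (hG : IsCritical k G.graph)
    (hiso : ∀ x, ∃ y, G.graph.Adj x y) (v : G.V) :
    ∃ (u : G.graph.neighborSet v ↪ Fin k) (_ : Fintype ({v}ᶜ : Set G.V)),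
      IsMeredithExtension k G ⟨_, meredithGraph k G.graph v u⟩ ∧
      IsCritical k (meredithGraph k G.graph v u) ∧
      ∀ x, ∃ y, (meredithGraph k G.graph v u).Adj x y := by
  classical
  have hdeg := ((isCritical_iff hk).1 hG).1.1 v
  obtain ⟨u⟩ : Nonempty (G.graph.neighborSet v ↪ Fin k) := by
    refine Function.Embedding.nonempty_of_card_le ?_
    rw [Fintype.card_fin, ← Set.toFinset_card, ← Set.ncard_eq_toFinset_card']
    exact hdeg
  exact ⟨u, inferInstance, ⟨hG.1, v, u, ⟨SimpleGraph.Iso.refl⟩⟩, hG.meredithGraph hk (hiso v),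
    exists_adj_meredithGraph hk hiso⟩

/-- Meredith extensions turn a critical graph into one of minimum degree at least `k - 1`. -/
lemma exists_reflTransGen_le_ncard (hk : 2 ≤ k) (n : ℕ) (G : FinGraph.{u})
    (hn : ∑ x, (k - 1 - (G.graph.neighborSet x).ncard) ≤ n) (hG : IsCritical k G.graph)
    (hiso : ∀ x, ∃ y, G.graph.Adj x y) :
    ∃ H : FinGraph.{u}, Relation.ReflTransGen (IsMeredithExtension k) G H ∧
      IsCritical k H.graph ∧ (∀ x, ∃ y, H.graph.Adj x y) ∧
      ∀ x, k - 1 ≤ (H.graph.neighborSet x).ncard := by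
  induction n generalizing G with
  | zero =>
    refine ⟨G, .refl, hG, hiso, fun x => ?_⟩
    have := (Finset.sum_eq_zero_iff.1 (Nat.le_zero.1 hn)) x (Finset.mem_univ x)
    omega
  | succ n ih =>
    by_cases hv : ∀ x, k - 1 ≤ (G.graph.neighborSet x).ncard
    · exact ⟨G, .refl, hG, hiso, hv⟩
    · push Not at hv
      obtain ⟨v, hv⟩ := hv
      obtain ⟨u, F, hext, hcrit, hiso'⟩ := exists_isMeredithExtension hk hG hiso v
      obtain ⟨H, hH, hH'⟩ := ih ⟨_, meredithGraph k G.graph v u⟩ (by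
        refine Nat.le_of_lt_succ (lt_of_lt_of_le (sum_lt_sum_of_inl_le (v := v)
          (fun x => ?_) ?_) hn)
        · rw [ncard_neighborSet_inl]
        -- No new vertex has a deficit, whereas that of `v` was positive.
        · rw [Finset.sum_eq_zero fun a _ => Nat.sub_eq_zero_of_le (le_ncard_neighborSet_inr a)]
          omega) hcrit hiso'
      exact ⟨H, .head hext hH, hH'⟩

/-- Meredith extensions make the paths of a path system as long as required. -/
lemma exists_reflTransGen_isPathSystem (hk : 2 ≤ k) (N n : ℕ) (G : FinGraph.{u}) (r : G.V → ℕ)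
    (l : G.V → Fin (k - 1) → List G.V) (hl : IsPathSystem G.graph k N r l) (hn : ∑ x, r x ≤ n)
    (hG : IsCritical k G.graph) (hiso : ∀ x, ∃ y, G.graph.Adj x y)
    (hdeg : ∀ x, k - 1 ≤ (G.graph.neighborSet x).ncard) :
    ∃ H : FinGraph.{u}, Relation.ReflTransGen (IsMeredithExtension k) G H ∧
      IsCritical k H.graph ∧ (∀ x, k - 1 ≤ (H.graph.neighborSet x).ncard) ∧
      ∃ l', IsPathSystem H.graph k N (fun _ => 0) l' := by
  induction n generalizing G with
  | zero =>
    have hr : r = fun _ => 0 := funext fun x =>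
      (Finset.sum_eq_zero_iff.1 (Nat.le_zero.1 hn)) x (Finset.mem_univ x)
    exact ⟨G, .refl, hG, hdeg, l, hr ▸ hl⟩
  | succ n ih =>
    by_cases hv : ∀ v, (G.graph.neighborSet v).ncard = k - 1 → r v = 0
    -- Values of `r` at vertices of degree other than `k - 1` play no role and may be reset to `0`.
    · exact ⟨G, .refl, hG, hdeg, l, hl.isChain, hl.nodup, hl.ncard_ne,
        fun v h i => hv v h ▸ hl.length v h i, hl.disjoint, hl.disjoint_of_ne⟩
    · push Not at hv
      obtain ⟨v, hv, hrv⟩ := hv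
      obtain ⟨u, F, hext, hcrit, hiso'⟩ := exists_isMeredithExtension hk hG hiso v
      obtain ⟨r', l', hl', hr'⟩ := hl.meredithGraph (u := u) hk hv hrv
      obtain ⟨H, hH, hH'⟩ := ih ⟨_, meredithGraph k G.graph v u⟩ r' l' hl'
        (Nat.le_of_lt_succ (lt_of_lt_of_le hr' hn)) hcrit hiso' (by
          rintro (x | a)
          · rw [ncard_neighborSet_inl]; exact hdeg x
          · exact le_ncard_neighborSet_inr a)
      exact ⟨H, .head hext hH, hH'⟩

end Sequences

end CriticalGraphs

theorem mainTheorem5 (k t : ℕ) (hk : 2 ≤ k) (G : CriticalGraphs.FinGraph.{u})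
    (hG : G ∈ CriticalGraphs.criticalClass k)
    (hiso : ∀ v : G.V, ∃ w : G.V, G.graph.Adj v w) :
    ∃ H ∈ CriticalGraphs.criticalClassPaths.{u} k t,
      Relation.ReflTransGen (CriticalGraphs.IsMeredithExtension k) G H := by
  classical
  obtain ⟨G', hGG', hG', hiso', hdeg'⟩ :=
    CriticalGraphs.exists_reflTransGen_le_ncard hk _ G le_rfl hG hiso
  -- Empty lists form a path system when the allowed deficit is the whole required length.
  have hnil : CriticalGraphs.IsPathSystem G'.graph k (2 * t * (k - 1) + 1)
      (fun _ => 2 * t * (k - 1) + 1) (fun _ _ => []) := by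
    constructor <;> simp
  obtain ⟨H, hH, hcrit, hdeg, l, hl⟩ :=
    CriticalGraphs.exists_reflTransGen_isPathSystem hk _ _ G' _ _ hnil le_rfl hG' hiso' hdeg'
  refine ⟨H, ⟨hcrit, ?_, hl.hasDistinguishedPaths fun _ => rfl⟩, hGG'.trans hH⟩
  have hmax := hcrit.1
  have : Nonempty H.V := by
    by_contra h
    rw [not_nonempty_iff] at h
    have : H.graph.maxDegree = 0 := by simp
    omega
  refine SimpleGraph.le_minDegree_of_forall_le_degree _ _ fun x => ?_
  rw [CriticalGraphs.degree_eq_ncard]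
  exact hdeg x
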